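/- **Model.** A one-hop $B_{cd}L$ beeping network with $n$ nodes is the complete graph $K_n$ with anonymous nodes, all running the same randomised local algorithm from the same initial state, with independent private random choices and without knowledge of $n$. Time is divided into synchronous slots. In each slot every active node either beeps or listens; a beeping node learns whether it beeped alone or whether some other node beeped too, and a listening node only distinguishes silence from the presence of at least one beep. Local computation between slots is unrestricted. A node may complete its computation with an output, after which it stays silent. The slot complexity of an execution is the number of slots until every node has completed its computation. A Las Vegas counting algorithm is one that, for every $n\ge 1$, on $K_n$ terminates with probability one and always (with probability one) makes every node output $n$. With high probability (w.h.p.) means with probability $1-o(n^{-1})$. **Algorithm 1.** Every node starts with $\mathit{counted}=\mathit{false}$, $k=2$, $\mathit{size}=1$, and repeats phases of three slots. Slot 1: if it is not counted, it beeps with probability $1/k$. Slot 2: if it is the only node that beeped in slot 1, it beeps and becomes counted. Slot 3: if it is not counted, it beeps. At the end of the phase: if another node beeped in slot 2, $\mathit{size}$ is increased by $1$; if no node beeped in slot 3, the node terminates with output $\mathit{size}$; if no node beeped in slot 1, $k$ is decreased by $1$ provided $k>2$; if there was a collision in slot 1 (at least two nodes beeped), $k$ is increased by $1$. **Corollary 1.**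 Algorithm 1 is optimal up to a constant factor for counting in one-hop $B_{cd}L$ networks. That is: 1. Algorithm 1 is a Las Vegas counting algorithm. 2. On $K_n$, Algorithm 1 terminates within $165\,n$ slots w.h.p. 3. Every Las Vegas counting algorithm in the $B_{cd}L$ model uses, for every $n\ge1$, at least $n$ slots on $K_n$ with probability one. 4. Consequently Algorithm 1 is optimal up to the factor $165$: whenever some Las Vegas counting algorithm $\mathcal B$ in the $B_{cd}L$ model and some $t:\mathbb N\to\mathbb N$ are such that, for all large $n$, $\mathcal B$ terminates on $K_n$ within $t(n)$ slots with positive probability, Algorithm 1 terminates on $K_n$ within $165\,t(n)$ slots w.h.p. -/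

import Mathlib

open MeasureTheory Filter

namespace Beeping

/-- What a node perceives in one slot of the `B_cd L` model. A beeping node learns whether it
beeped alone among its neighbours and itself (sender-side collision detection); a listening node
only distinguishes silence from the presence of at least one beep. -/
inductive Feedback : Type
  | beepedAlone
  | beepedCollision
  | heardSilence
  | heardBeep
  deriving DecidableEq

/-- A local randomised algorithm for the `B_cd L` beeping model. The network is anonymous: all the
nodes run the same algorithm from the same initial state and are not told the size of the network.
In each slot a node draws a fresh private random value with distribution `law`; a node whose
`output` is not `none` has completed its computation with that value. State space, source of
randomness and (measurable) transition functions are arbitrary: local computation is unrestricted.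
-/
structure Algorithm where
  State : Type
  [measurableState : MeasurableSpace State]
  Coin : Type
  [measurableCoin : MeasurableSpace Coin]
  law : Measure Coin
  [isProbabilityMeasure_law : IsProbabilityMeasure law]
  init : State
  output : State → Option ℕ
  beep : State → Coin → Bool
  next : State → Feedback → Coin → State
  measurableSet_output : ∀ o : Option ℕ, MeasurableSet {s | output s = o}
  measurable_beep : Measurable fun p : State × Coin => beep p.1 p.2
  measurable_next : ∀ f : Feedback, Measurable fun p : State × Coin => next p.1 f p.2

namespace Algorithm

attribute [instance] measurableState measurableCoin isProbabilityMeasure_law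

variable (A : Algorithm) {V : Type}

/-- The random choices of all the nodes: node `x` draws `ω x t` in slot `t`. -/
abbrev Tape (V : Type) : Type := V → ℕ → A.Coin

/-- All the draws, of all nodes and in all slots, are independent with distribution `A.law`. -/
noncomputable def prob (V : Type) [Fintype V] : Measure (A.Tape V) :=
  Measure.pi fun _ : V => Measure.infinitePi fun _ : ℕ => A.law

/-- A node beeps if it is still active and its algorithm tells it to; otherwise an active node
listens, and a node that has completed its computation stays silent. -/
def Beeps (s : A.State) (c : A.Coin) : Prop := A.output s = none ∧ A.beep s c = true

open Classical in
/-- What node `x` perceives in a slot of the network `G`, if the nodes are in the states `σ` and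
draw the values `c`. -/
noncomputable def feedback (G : SimpleGraph V) (σ : V → A.State) (c : V → A.Coin) (x : V) :
    Feedback :=
  if A.Beeps (σ x) (c x) then
    if ∃ y, G.Adj x y ∧ A.Beeps (σ y) (c y) then .beepedCollision else .beepedAlone
  else
    if ∃ y, G.Adj x y ∧ A.Beeps (σ y) (c y) then .heardBeep else .heardSilence

/-- One synchronous slot: every active node updates its state. -/
noncomputable def step (G : SimpleGraph V) (σ : V → A.State) (c : V → A.Coin) : V → A.State :=
  fun x => if A.output (σ x) = none then A.next (σ x) (A.feedback G σ c x) (c x) else σ x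

/-- The states of the nodes after `t` slots of the execution on `G` with random choices `ω`. -/
noncomputable def run (G : SimpleGraph V) (ω : A.Tape V) : ℕ → V → A.State
  | 0 => fun _ => A.init
  | t + 1 => A.step G (run G ω t) fun x => ω x t

/-- The number of slots until every node has completed its computation (`⊤` if this never
happens). -/
noncomputable def slots (G : SimpleGraph V) (ω : A.Tape V) : ℕ∞ :=
  sInf {T | ∃ t : ℕ, T = t ∧ ∀ x, A.output (A.run G ω t x) ≠ none}

/-- The one-hop network with `n` nodes: the complete graph. -/
abbrev oneHop (n : ℕ) : SimpleGraph (Fin n) := ⊤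

/-- `A` is a Las Vegas algorithm for counting in one-hop networks: on every nonempty one-hop
network, with probability one, it terminates and every node outputs the number of nodes. -/
def IsLasVegasCounting : Prop :=
  ∀ n : ℕ, 1 ≤ n → ∀ᵐ ω ∂A.prob (Fin n),
    A.slots (oneHop n) ω < ⊤ ∧
      ∀ (t : ℕ) (x : Fin n) (m : ℕ), A.output (A.run (oneHop n) ω t x) = some m → m = n

/-- The events `E n`, about the execution of `A` on networks with `n` nodes, hold with high
probability: with probability `1 - o(1/n)`. -/
def WithHighProbability (E : ∀ n : ℕ, Set (A.Tape (Fin n))) : Prop :=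
  (fun n : ℕ => (A.prob (Fin n)).real (E n)ᶜ) =o[atTop] fun n : ℕ => (n : ℝ)⁻¹

/-- `A` is optimal up to the factor `C` for counting in one-hop `B_cd L` networks: it is a
Las Vegas counting algorithm, and whenever some Las Vegas counting algorithm `B` has (for all large
`n`) a nonzero chance to complete within `t n` slots on `n` nodes, `A` completes within `C * t n`
slots with high probability. -/
def IsOptimalUpTo (C : ℕ) : Prop :=
  A.IsLasVegasCounting ∧
    ∀ B : Algorithm, B.IsLasVegasCounting → ∀ t : ℕ → ℕ,
      (∀ᶠ n in atTop, 0 < B.prob (Fin n) {ω | B.slots (oneHop n) ω ≤ t n}) →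
        A.WithHighProbability fun n => {ω | A.slots (oneHop n) ω ≤ (C * t n : ℕ)}

end Algorithm

/-! The counting algorithm whose optimality is claimed. -/

/-- The three slots of a phase. -/
inductive PhaseSlot : Type
  | one
  | two
  | three
  deriving DecidableEq

/-- The variables of a node; `fb₁` and `fb₂` store what the node perceived in slots 1 and 2 of the
current phase, for use later in that phase. -/
@[ext]
structure CountState : Type where
  slot : PhaseSlot
  counted : Bool
  terminated : Bool
  k : ℕ
  size : ℕ
  fb₁ : Feedback
  fb₂ : Feedback

namespace CountState

instance : MeasurableSpace CountState := ⊤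

instance : DiscreteMeasurableSpace CountState := ⟨fun _ => trivial⟩

instance : Countable PhaseSlot := by
  refine Function.Injective.countable (β := ℕ)
    (f := fun s => match s with | .one => 0 | .two => 1 | .three => 2) ?_
  intro a b h
  cases a <;> cases b <;> simp_all

instance : Countable Feedback := by
  refine Function.Injective.countable (β := ℕ)
    (f := fun s => match s with
      | .beepedAlone => 0 | .beepedCollision => 1 | .heardSilence => 2 | .heardBeep => 3) ?_
  intro a b h
  cases a <;> cases b <;> simp_all

instance : Countable CountState := by
  refine Function.Injective.countable
    (f := fun s : CountState =>
      (s.slot, s.counted, s.terminated, s.k, s.size, s.fb₁, s.fb₂)) ?_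
  intro a b h
  simp only [Prod.mk.injEq] at h
  ext1 <;> simp [h]

/-- Initially: `counted = false`, `terminated = false`, `k = 2`, `size = 1`, before slot 1.
The initial values of `fb₁`, `fb₂` are immaterial: they are overwritten before being read. -/
def start : CountState := ⟨.one, false, false, 2, 1, .heardSilence, .heardSilence⟩

/-- A collision in slot 1 is known to the nodes that beeped in it; the listening nodes know of it
when they heard a beep in slot 1 and silence in slot 2. -/
def Collision (s : CountState) : Prop :=
  s.fb₁ = .beepedCollision ∨ (s.fb₁ = .heardBeep ∧ s.fb₂ = .heardSilence)

instance (s : CountState) : Decidable s.Collision :=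
  inferInstanceAs (Decidable (_ ∨ (_ ∧ _)))

/-- The adjustment of `k` at the end of a phase. -/
def newK (s : CountState) : ℕ :=
  if s.fb₁ = .heardSilence then
    if 2 < s.k then s.k - 1 else s.k
  else if s.Collision then s.k + 1 else s.k

/-- Slot 1: a node that is not counted beeps with probability `1/k` (`c` is uniform in `[0,1]`).
Slot 2: a node beeps if it is the only one that beeped in slot 1.
Slot 3: a node beeps if it is not counted. -/
noncomputable def beep (s : CountState) (c : unitInterval) : Bool :=
  match s.slot with
  | .one => !s.counted && decide ((c : ℝ) < 1 / (s.k : ℝ))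
  | .two => decide (s.fb₁ = .beepedAlone)
  | .three => !s.counted

/-- The local computation after each slot; `f` is what the node perceived in that slot. After
slot 3 comes the end of the phase: `size` is increased if a neighbour beeped in slot 2, the node
terminates if no one beeped in slot 3, and `k` is adjusted. -/
def next (s : CountState) (f : Feedback) : CountState :=
  match s.slot with
  | .one => { s with slot := .two, fb₁ := f }
  | .two => { s with
      slot := .three
      fb₂ := f
      counted := s.counted || decide (s.fb₁ = .beepedAlone) }
  | .three => { s with
      slot := .one
      size := if s.fb₂ = .heardBeep ∨ s.fb₂ = .beepedCollision then s.size + 1 else s.size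
      terminated := decide (f = .heardSilence)
      k := s.newK }

end CountState

open CountState in
/-- The three-slot counting algorithm with adaptive probability `1/k`. -/
noncomputable def countAlgorithm : Algorithm where
  State := CountState
  Coin := unitInterval
  law := volume
  init := start
  output s := if s.terminated then some s.size else none
  beep := CountState.beep
  next s f _ := s.next f
  measurableSet_output _ := MeasurableSet.of_discrete
  measurable_beep := by
    refine measurable_from_prod_countable_right fun s => ?_
    rcases h : s.slot with _ | _ | _
    · have : MeasurableSet {c : unitInterval | (c : ℝ) < 1 / (s.k : ℝ)} :=
        measurableSet_lt measurable_subtype_coe measurable_const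
      simp only [CountState.beep, h]
      refine (measurable_of_finite fun b : Bool => !s.counted && b).comp ?_
      exact measurable_to_bool (by simpa [Set.preimage] using this)
    · simp only [CountState.beep, h]
      exact @measurable_const _ _ _ _ (decide (s.fb₁ = .beepedAlone))
    · simp only [CountState.beep, h]
      exact measurable_const
  measurable_next f := (measurable_of_countable fun s : CountState => s.next f).comp measurable_fst

end Beeping

/-! Lower bound. At most one node beeps alone in a slot, so after `t < n` slots some node `v` has
never done so. Add a copy of `v` that behaves like it: when `v` beeps there is already another
beeper, so no perception changes, neither for `v` and its copy nor for the rest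
(`perceived_duplicate`). For a fixed pattern of beeps, what each node perceives is fixed, so the
event "this pattern occurs and all nodes output `n`" constrains the nodes' tapes separately and its
probability is a product over nodes. On `n + 1` nodes the same product appears with the factor of
`v` squared, and it vanishes because the output `n` is wrong there. Hence a factor vanishes, and the
event is null on `n` nodes too. Countably many patterns give `IsLasVegasCounting.le_slots`.

Upper bound. A phase is one step of a chain on pairs (set of counted nodes, `k`), driven by the
slot-1 draws alone (`Represents.phase`); correctness of outputs follows with no probability. With
`r` uncounted nodes the potential is `(5/4) ^ (8r + |k - r|)`, and 0 once `r = 0`. A lone beep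
lowers the exponent by at least 7; silence and collision move `k` by at most 1. In expectation a
phase multiplies the potential by at most 91/100 (`weight_drift`). It starts at or below `(5/4) ^
(9n)`, so by Markov's inequality `55 n` phases leave an uncounted node with probability at most `2 ^
(-n)`; letting the number of phases grow gives almost sure termination. -/

namespace Beeping

/-! ### Lower bound: duplicating a node that never beeps alone -/

namespace Algorithm

variable (A : Algorithm) {V : Type}

/-- The state after `t` slots of a single node that perceives `f` and draws the values `c`. -/
noncomputable def localRun (f : ℕ → Feedback) (c : ℕ → A.Coin) : ℕ → A.State
  | 0 => A.init
  | t + 1 =>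
    if A.output (localRun f c t) = none then A.next (localRun f c t) (f t) (c t)
    else localRun f c t

open Classical in
/-- What node `x` perceives in a slot in which exactly the nodes in `B` beep. -/
noncomputable def perceived (G : SimpleGraph V) (B : Set V) (x : V) : Feedback :=
  if x ∈ B then
    if ∃ y, G.Adj x y ∧ y ∈ B then .beepedCollision else .beepedAlone
  else
    if ∃ y, G.Adj x y ∧ y ∈ B then .heardBeep else .heardSilence

lemma perceived_congr {W : Type} {G : SimpleGraph V} {G' : SimpleGraph W} {B : Set V} {B' : Set W}
    {x : V} {x' : W} (h : x ∈ B ↔ x' ∈ B')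
    (hex : (∃ y, G.Adj x y ∧ y ∈ B) ↔ ∃ y, G'.Adj x' y ∧ y ∈ B') :
    perceived G B x = perceived G' B' x' := by
  classical
  exact if_congr h (if_congr hex rfl rfl) (if_congr hex rfl rfl)

variable {A}

lemma feedback_eq_perceived {G : SimpleGraph V} {σ : V → A.State} {c : V → A.Coin} {B : Set V}
    (h : ∀ y, A.Beeps (σ y) (c y) ↔ y ∈ B) (x : V) :
    A.feedback G σ c x = perceived G B x := by
  have hex : (∃ y, G.Adj x y ∧ A.Beeps (σ y) (c y)) ↔ ∃ y, G.Adj x y ∧ y ∈ B := by simp only [h]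
  classical
  exact if_congr (h x) (if_congr hex rfl rfl) (if_congr hex rfl rfl)

/-- A self-consistent guess of all perceptions is the true one, by induction on time. Under such a
guess each node's evolution depends on its own tape only, which is what makes events factor over
nodes. -/
lemma run_eq_localRun {G : SimpleGraph V} {ω : A.Tape V} {f : V → ℕ → Feedback} {T : ℕ}
    (h : ∀ t < T, ∀ x, A.feedback G (fun y => A.localRun (f y) (ω y) t) (fun y => ω y t) x = f x t) :
    ∀ t ≤ T, A.run G ω t = fun x => A.localRun (f x) (ω x) t := by
  intro t
  induction t with
  | zero => intro _; rfl
  | succ t ih =>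
    intro ht
    have ih := ih (by omega)
    funext x
    simp only [run, step, localRun, ih, h t (by omega)]

lemma slots_le_of_output {G : SimpleGraph V} {ω : A.Tape V} {t : ℕ}
    (h : ∀ x, A.output (A.run G ω t x) ≠ none) : A.slots G ω ≤ t :=
  sInf_le ⟨t, rfl, h⟩

lemma exists_output_of_slots_lt {G : SimpleGraph V} {ω : A.Tape V} {n : ℕ∞}
    (h : A.slots G ω < n) : ∃ t : ℕ, (t : ℕ∞) < n ∧ ∀ x, A.output (A.run G ω t x) ≠ none := by
  obtain ⟨_, ⟨t, rfl, ht⟩, hlt⟩ := sInf_lt_iff.1 h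
  exact ⟨t, hlt, ht⟩

variable (A) in
/-- The private random choices with which a node that perceives `f` beeps, in the first `t` slots,
exactly in the slots in `b`, and has completed its computation with output `m` by then. -/
def compatible (f : ℕ → Feedback) (b : Set ℕ) (t m : ℕ) : Set (ℕ → A.Coin) :=
  {c | (∀ s < t, A.Beeps (A.localRun f c s) (c s) ↔ s ∈ b) ∧ A.output (A.localRun f c t) = some m}

/-- If fewer slots than nodes have passed, some node has never beeped alone. -/
lemma exists_never_alone {n t : ℕ} (h : t < n) (B : ℕ → Set (Fin n)) :
    ∃ v, ∀ s < t, v ∈ B s → ∃ y, v ≠ y ∧ y ∈ B s := by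
  by_contra! hc
  choose s hs hmem halone using hc
  have hinj : Function.Injective fun v => (⟨s v, hs v⟩ : Fin t) := by
    intro v w hvw
    have hvw : s v = s w := by simpa using hvw
    by_contra hne
    exact halone v w hne (hvw ▸ hmem w)
  have := Fintype.card_le_of_injective _ hinj
  simp at this
  omega

/-- Duplicating a node that does not beep alone does not change what the nodes perceive. -/
lemma perceived_duplicate {n : ℕ} {B : Set (Fin n)} {v : Fin n}
    (hv : v ∈ B → ∃ y, v ≠ y ∧ y ∈ B) (x : Fin (n + 1)) :
    perceived (oneHop (n + 1)) ((Fin.cons v id : Fin (n + 1) → Fin n) ⁻¹' B) x =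
      perceived (oneHop n) B ((Fin.cons v id : Fin (n + 1) → Fin n) x) := by
  set π : Fin (n + 1) → Fin n := Fin.cons v id with hπ
  have h0 : π 0 = v := rfl
  have hs : ∀ i : Fin n, π i.succ = i := fun i => rfl
  have key : (∃ y, (oneHop (n + 1)).Adj x y ∧ y ∈ π ⁻¹' B) ↔
      ∃ y, (oneHop n).Adj (π x) y ∧ y ∈ B := by
    simp only [SimpleGraph.top_adj, Set.mem_preimage]
    constructor
    · rintro ⟨y, hxy, hy⟩
      -- Distinct nodes with the same image are the two copies of `v`; then `hv` supplies a genuine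
      -- second beeper.
      by_cases hne : π x = π y
      · have hπv : π x = v := by
          rcases Fin.eq_zero_or_eq_succ x with rfl | ⟨i, rfl⟩
          · exact h0
          rcases Fin.eq_zero_or_eq_succ y with rfl | ⟨j, rfl⟩
          · exact hne
          · simp only [hs] at hne
            exact absurd (congrArg Fin.succ hne) hxy
        rw [← hne, hπv] at hy
        rw [hπv]
        exact hv hy
      · exact ⟨π y, hne, hy⟩
    · rintro ⟨y, hxy, hy⟩
      refine ⟨y.succ, fun hx => hxy ?_, by simpa [hs] using hy⟩
      rw [hx, hs]
  exact perceived_congr Iff.rfl key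

/-- `R` is a beeping pattern, as a set of (slot, node) pairs. Transferred to `n + 1` nodes along
`π`, it would force the wrong output `n`, so there it has probability zero; both probabilities are
products of the same factors, up to multiplicity. -/
lemma IsLasVegasCounting.prob_pi_compatible_eq_zero (hA : A.IsLasVegasCounting) {n t : ℕ}
    (h : t < n) (R : Finset (ℕ × Fin n)) :
    A.prob (Fin n) (Set.univ.pi fun x =>
      A.compatible (fun s => perceived (oneHop n) {y | (s, y) ∈ R} x) {s | (s, x) ∈ R} t n) = 0 := by
  set E : Fin n → Set (ℕ → A.Coin) := fun x =>
    A.compatible (fun s => perceived (oneHop n) {y | (s, y) ∈ R} x) {s | (s, x) ∈ R} t n with hE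
  obtain ⟨v, hv⟩ := exists_never_alone h fun s => {y | (s, y) ∈ R}
  set π : Fin (n + 1) → Fin n := Fin.cons v id with hπ
  have hnull : A.prob (Fin (n + 1)) (Set.univ.pi fun x => E (π x)) = 0 := by
    refine measure_mono_null ?_ (ae_iff.1 (hA (n + 1) (by omega)))
    intro ω hω hbad
    have hω : ∀ x, ω x ∈ E (π x) := by simpa using hω
    have hrun := run_eq_localRun (G := oneHop (n + 1)) (ω := ω) (T := t)
      (f := fun x s => perceived (oneHop n) {y | (s, y) ∈ R} (π x)) (by
        intro s hs x
        rw [← perceived_duplicate (hv s hs) x]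
        exact feedback_eq_perceived (fun y => (hω y).1 s hs) x) t le_rfl
    have hout := (hω 0).2
    have := hbad.2 t 0 n (by rw [hrun]; exact hout)
    omega
  -- The larger product only repeats the factor of `v`, so a factor that vanishes in it also occurs
  -- in the smaller one.
  rw [prob, Measure.pi_pi] at hnull ⊢
  obtain ⟨x, -, hx⟩ := Finset.prod_eq_zero_iff.1 hnull
  exact Finset.prod_eq_zero (Finset.mem_univ (π x)) hx

-- An execution that is correct and complete after `t < n` slots realises its own finite beeping
-- pattern, and every such pattern is null.
open Classical in
theorem IsLasVegasCounting.le_slots (hA : A.IsLasVegasCounting) {n : ℕ} (hn : 1 ≤ n) :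
    ∀ᵐ ω ∂A.prob (Fin n), (n : ℕ∞) ≤ A.slots (oneHop n) ω := by
  -- Patterns are `Finset`s so that there are countably many of them.
  have hnull : ∀ᵐ ω ∂A.prob (Fin n), ∀ (t : Fin n) (R : Finset (ℕ × Fin n)),
      ω ∉ Set.univ.pi fun x => A.compatible
        (fun s => perceived (oneHop n) {y | (s, y) ∈ R} x) {s | (s, x) ∈ R} t n := by
    rw [ae_all_iff]
    intro t
    rw [ae_all_iff]
    intro R
    exact measure_eq_zero_iff_ae_notMem.1 (hA.prob_pi_compatible_eq_zero t.2 R)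
  filter_upwards [hnull, hA n hn] with ω hω hcorrect
  by_contra! hlt
  obtain ⟨t, htn, ht⟩ := exists_output_of_slots_lt hlt
  have htn : t < n := by exact_mod_cast htn
  let R : Finset (ℕ × Fin n) := (Finset.range t ×ˢ Finset.univ).filter fun p =>
    A.Beeps (A.run (oneHop n) ω p.1 p.2) (ω p.2 p.1)
  have hR : ∀ s < t, ∀ x, (s, x) ∈ R ↔ A.Beeps (A.run (oneHop n) ω s x) (ω x s) := by
    intro s hs x
    simp [R, hs]
  have hrun : ∀ s ≤ t, A.run (oneHop n) ω s = fun x =>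
      A.localRun (fun s => perceived (oneHop n) {y | (s, y) ∈ R} x) (ω x) s := by
    intro s
    induction s with
    | zero => intro _; rfl
    | succ s ih =>
      intro hs
      have ih := ih (by omega)
      funext x
      have hfb := feedback_eq_perceived (G := oneHop n) (B := {y | (s, y) ∈ R})
        (fun y => (hR s (by omega) y).symm) x
      simp only [run, step, localRun, hfb]
      rw [ih]
  refine hω ⟨t, htn⟩ R ?_
  intro x _
  refine ⟨fun s hs => ?_, ?_⟩
  · have := hR s hs x
    rw [hrun s hs.le] at this
    exact this.symm
  · obtain ⟨m, hm⟩ := Option.ne_none_iff_exists'.1 (ht x)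
    have hmn := hcorrect.2 t x m hm
    rw [hrun t le_rfl] at hm
    exact hm.trans (congrArg some hmn)

end Algorithm

end Beeping

/-! ### The potential and its drift -/

namespace Beeping

/-- The potential of `r` uncounted nodes with beeping probability `1 / k`. -/
noncomputable def weight (r k : ℕ) : ℝ :=
  if r = 0 then 0 else (5 / 4) ^ (8 * r + (k - r) + (r - k))

lemma weight_nonneg (r k : ℕ) : 0 ≤ weight r k := by
  unfold weight
  split_ifs <;> positivity

lemma weight_le (r k : ℕ) : weight r k ≤ (5 / 4) ^ (8 * r + (k - r) + (r - k)) := by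
  unfold weight
  split_ifs
  · positivity
  · exact le_rfl

lemma weight_of_pos {r : ℕ} (hr : 1 ≤ r) (k : ℕ) :
    weight r k = (5 / 4) ^ (8 * r + (k - r) + (r - k)) :=
  if_neg (by omega)

/-- With the value 0 at `r = 0`, "potential at least 1" means exactly "some node is uncounted", the
form Markov's inequality needs. -/
lemma one_le_weight {r : ℕ} (hr : 1 ≤ r) (k : ℕ) : 1 ≤ weight r k := by
  rw [weight_of_pos hr]
  exact one_le_pow₀ (by norm_num)

/-- The right side is `(1 + 1/m) ^ (-m)`, which is at least `1/e`. -/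
lemma one_third_le_one_sub_inv_pow (m : ℕ) : (1 / 3 : ℝ) ≤ (1 - 1 / (m + 1 : ℝ)) ^ m := by
  rcases Nat.eq_zero_or_pos m with rfl | hm
  · norm_num
  have hm' : (0 : ℝ) < m := by exact_mod_cast hm
  have h1 : (1 + 1 / (m : ℝ)) ^ m ≤ 3 := by
    calc (1 + 1 / (m : ℝ)) ^ m ≤ Real.exp (1 / m) ^ m := by
          gcongr
          linarith [Real.add_one_le_exp (1 / (m : ℝ))]
      _ = Real.exp 1 := by
          rw [← Real.exp_nat_mul]
          congr 1
          field_simp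
      _ ≤ 3 := Real.exp_one_lt_three.le
  have h2 : (1 - 1 / (m + 1 : ℝ)) = (1 + 1 / (m : ℝ))⁻¹ := by
    field_simp
    ring
  rw [h2, inv_pow, one_div]
  exact inv_anti₀ (by positivity) h1

/-- The probability that exactly one of `r` nodes beeps, if each beeps with probability `1 / k`. -/
noncomputable def aloneProb (r k : ℕ) : ℝ := r * (1 / k * (1 - 1 / k : ℝ) ^ (r - 1))

lemma one_sub_inv_mem {k : ℕ} (hk : 2 ≤ k) : 0 ≤ (1 - 1 / k : ℝ) ∧ (1 - 1 / k : ℝ) ≤ 1 := by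
  have hk' : (2 : ℝ) ≤ k := by exact_mod_cast hk
  have : (1 / k : ℝ) ≤ 1 := by
    rw [div_le_one (by linarith)]; linarith
  exact ⟨by linarith, by have : (0 : ℝ) ≤ 1 / k := by positivity
                         linarith⟩

lemma aloneProb_nonneg (r : ℕ) {k : ℕ} (hk : 2 ≤ k) : 0 ≤ aloneProb r k := by
  have := (one_sub_inv_mem hk).1
  unfold aloneProb
  positivity

lemma le_aloneProb {r k : ℕ} (hk : 2 ≤ k) (hrk : r ≤ k) : (r / k : ℝ) / 3 ≤ aloneProb r k := by
  obtain ⟨h0, h1⟩ := one_sub_inv_mem hk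
  have h2 : (1 / 3 : ℝ) ≤ (1 - 1 / k : ℝ) ^ (r - 1) := by
    calc (1 / 3 : ℝ) ≤ (1 - 1 / k : ℝ) ^ (k - 1) := by
          have := one_third_le_one_sub_inv_pow (k - 1)
          rw [Nat.cast_sub (by omega)] at this
          simpa using this
      _ ≤ _ := pow_le_pow_of_le_one h0 h1 (by omega)
  have h3 : (0 : ℝ) ≤ r / k := by positivity
  calc (r / k : ℝ) / 3 = (r / k : ℝ) * (1 / 3) := by ring
    _ ≤ (r / k : ℝ) * (1 - 1 / k : ℝ) ^ (r - 1) := by gcongr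
    _ = aloneProb r k := by unfold aloneProb; ring

/-- After removing the common factor `(1 - 1/k) ^ (r - 1)`, this is `1 - 1/k ≤ 1 ≤ r/k`. -/
lemma silenceProb_le_aloneProb {r k : ℕ} (hk : 2 ≤ k) (hkr : k ≤ r) :
    (1 - 1 / k : ℝ) ^ r ≤ aloneProb r k := by
  obtain ⟨h0, h1⟩ := one_sub_inv_mem hk
  have hk0 : (0 : ℝ) < k := by exact_mod_cast (by omega : 0 < k)
  obtain ⟨s, rfl⟩ : ∃ s, r = s + 1 := ⟨r - 1, by omega⟩
  have h2 : (1 - 1 / k : ℝ) ≤ ((s + 1 : ℕ) : ℝ) * (1 / k) := by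
    have : (k : ℝ) ≤ ((s + 1 : ℕ) : ℝ) := by exact_mod_cast hkr
    calc (1 - 1 / k : ℝ) ≤ 1 := h1
      _ = k * (1 / k) := by field_simp
      _ ≤ _ := by gcongr
  unfold aloneProb
  rw [pow_succ, Nat.add_sub_cancel, ← mul_assoc, mul_comm]
  gcongr

/-- The expected potential decreases geometrically. -/
lemma weight_drift {r k : ℕ} (hr : 1 ≤ r) (hk : 2 ≤ k) :
    (1 - 1 / k : ℝ) ^ r * weight r (if 2 < k then k - 1 else k) + aloneProb r k * weight (r - 1) k
      + (1 - (1 - 1 / k : ℝ) ^ r - aloneProb r k) * weight r (k + 1) ≤ 91 / 100 * weight r k := by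
  obtain ⟨h0, h1⟩ := one_sub_inv_mem hk
  have hp0 : 0 ≤ (1 - 1 / k : ℝ) ^ r := by positivity
  have hp1 := aloneProb_nonneg r hk
  have hW := mul_le_mul_of_nonneg_left (weight_le (r - 1) k) hp1
  rw [weight_of_pos hr, weight_of_pos hr, weight_of_pos hr]
  have hk0 : (0 : ℝ) < k := by exact_mod_cast (by omega : 0 < k)
  rcases lt_trichotomy k r with hlt | heq | hgt
  -- `k` too small: a collision improves `k`, and the damage of silence is paid for by the lone
  -- beep, which is at least as likely. With `Z` factored out, the exponents are at most 10
  -- (silence), 0 (lone beep) and 8 (collision), against 9 before.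
  · obtain ⟨d, rfl⟩ : ∃ d, r = k + 1 + d := ⟨r - (k + 1), by omega⟩
    have hle := silenceProb_le_aloneProb hk hlt.le
    set p0 := (1 - 1 / k : ℝ) ^ (k + 1 + d)
    set p1 := aloneProb (k + 1 + d) k
    set Z : ℝ := (5 / 4) ^ (8 * (k + d) + d) with hZ
    have hZ0 : 0 < Z := by positivity
    have e0 : (5 / 4 : ℝ) ^ (8 * (k + 1 + d) + ((if 2 < k then k - 1 else k) - (k + 1 + d)) +
        (k + 1 + d - (if 2 < k then k - 1 else k))) ≤ Z * (5 / 4) ^ 10 := by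
      rw [hZ, ← pow_add]
      apply pow_le_pow_right₀ (by norm_num)
      split_ifs <;> omega
    have e1 : (5 / 4 : ℝ) ^ (8 * (k + 1 + d - 1) + (k - (k + 1 + d - 1)) + (k + 1 + d - 1 - k)) = Z := by
      rw [hZ]; congr 1; omega
    have e2 : (5 / 4 : ℝ) ^ (8 * (k + 1 + d) + (k + 1 - (k + 1 + d)) + (k + 1 + d - (k + 1))) =
        Z * (5 / 4) ^ 8 := by
      rw [hZ, ← pow_add]; congr 1; omega
    have e3 : (5 / 4 : ℝ) ^ (8 * (k + 1 + d) + (k - (k + 1 + d)) + (k + 1 + d - k)) =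
        Z * (5 / 4) ^ 9 := by
      rw [hZ, ← pow_add]; congr 1; omega
    have hW0 := mul_le_mul_of_nonneg_left e0 hp0
    rw [e1] at hW
    rw [e2, e3]
    have : p0 * (Z * (5 / 4) ^ 10) + p1 * Z + (1 - p0 - p1) * (Z * (5 / 4) ^ 8) ≤
        91 / 100 * (Z * (5 / 4) ^ 9) := by
      have : p0 * (5 / 4) ^ 10 + p1 + (1 - p0 - p1) * (5 / 4) ^ 8 ≤ 91 / 100 * (5 / 4 : ℝ) ^ 9 := by
        norm_num
        linarith
      nlinarith
    linarith
  · subst heq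
    -- `k = r`: every other outcome may raise the exponent by 1, but a lone beep has probability at
    -- least 1/3 and lowers it by 7.
    have hle := le_aloneProb hk le_rfl
    rw [div_self hk0.ne'] at hle
    set p0 := (1 - 1 / k : ℝ) ^ k
    set p1 := aloneProb k k
    set Z : ℝ := (5 / 4) ^ (8 * (k - 1)) with hZ
    have hZ0 : 0 < Z := by positivity
    have e0 : (5 / 4 : ℝ) ^ (8 * k + ((if 2 < k then k - 1 else k) - k) +
        (k - (if 2 < k then k - 1 else k))) ≤ Z * (5 / 4) ^ 9 := by
      rw [hZ, ← pow_add]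
      apply pow_le_pow_right₀ (by norm_num)
      split_ifs <;> omega
    have e1 : (5 / 4 : ℝ) ^ (8 * (k - 1) + (k - (k - 1)) + (k - 1 - k)) = Z * (5 / 4) ^ 1 := by
      rw [hZ, ← pow_add]; congr 1; omega
    have e2 : (5 / 4 : ℝ) ^ (8 * k + (k + 1 - k) + (k - (k + 1))) = Z * (5 / 4) ^ 9 := by
      rw [hZ, ← pow_add]; congr 1; omega
    have e3 : (5 / 4 : ℝ) ^ (8 * k + (k - k) + (k - k)) = Z * (5 / 4) ^ 8 := by
      rw [hZ, ← pow_add]; congr 1; omega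
    have hW0 := mul_le_mul_of_nonneg_left e0 hp0
    rw [e1] at hW
    rw [e2, e3]
    have : p0 * (Z * (5 / 4) ^ 9) + p1 * (Z * (5 / 4) ^ 1) + (1 - p0 - p1) * (Z * (5 / 4) ^ 9) ≤
        91 / 100 * (Z * (5 / 4) ^ 8) := by
      have : (1 - p1) * (5 / 4) ^ 9 + p1 * (5 / 4) ≤ 91 / 100 * (5 / 4 : ℝ) ^ 8 := by
        norm_num
        linarith
      nlinarith
    linarith
  -- `k` too large: with `ρ = r/k`, silence, which improves `k`, has probability at least `1 - ρ` by
  -- Bernoulli, and a lone beep at least `ρ/3`. The bound is worst at `ρ = 1`.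
  · have hle := le_aloneProb hk hgt.le
    have hbern : 1 - (r / k : ℝ) ≤ (1 - 1 / k : ℝ) ^ r := by
      have := one_add_mul_le_pow (a := -(1 / k : ℝ)) (by linarith) r
      calc 1 - (r / k : ℝ) = 1 + r * -(1 / k : ℝ) := by ring
        _ ≤ _ := this
        _ = _ := by ring
    have hρ : (r / k : ℝ) ≤ 1 := by
      rw [div_le_one hk0]; exact_mod_cast hgt.le
    have hρ0 : (0 : ℝ) ≤ r / k := by positivity
    obtain ⟨d, rfl⟩ : ∃ d, k = r + 1 + d := ⟨k - (r + 1), by omega⟩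
    -- The floor `k = 2` stops silence from improving `k` only when `r = 1`; there the probabilities
    -- are explicit.
    have hsmall : ¬ 2 < r + 1 + d →
        (1 - 1 / ((r + 1 + d : ℕ) : ℝ)) ^ r = 1 / 2 ∧ aloneProb r (r + 1 + d) = 1 / 2 := by
      intro h
      obtain rfl : r = 1 := by omega
      obtain rfl : d = 0 := by omega
      norm_num [aloneProb]
    set ρ : ℝ := r / ((r + 1 + d : ℕ) : ℝ)
    set p0 := (1 - 1 / ((r + 1 + d : ℕ) : ℝ)) ^ r
    set p1 := aloneProb r (r + 1 + d)
    set Z : ℝ := (5 / 4) ^ (8 * (r - 1) + d) with hZ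
    have hZ0 : 0 < Z := by positivity
    have e1 : (5 / 4 : ℝ) ^ (8 * (r - 1) + (r + 1 + d - (r - 1)) + (r - 1 - (r + 1 + d))) =
        Z * (5 / 4) ^ 2 := by
      rw [hZ, ← pow_add]; congr 1; omega
    have e2 : (5 / 4 : ℝ) ^ (8 * r + (r + 1 + d + 1 - r) + (r - (r + 1 + d + 1))) =
        Z * (5 / 4) ^ 10 := by
      rw [hZ, ← pow_add]; congr 1; omega
    have e3 : (5 / 4 : ℝ) ^ (8 * r + (r + 1 + d - r) + (r - (r + 1 + d))) = Z * (5 / 4) ^ 9 := by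
      rw [hZ, ← pow_add]; congr 1; omega
    rw [e1] at hW
    rw [e2, e3]
    split_ifs with h2
    · have e0 : (5 / 4 : ℝ) ^ (8 * r + (r + 1 + d - 1 - r) + (r - (r + 1 + d - 1))) =
          Z * (5 / 4) ^ 8 := by
        rw [hZ, ← pow_add]; congr 1; omega
      rw [e0]
      have : p0 * (Z * (5 / 4) ^ 8) + p1 * (Z * (5 / 4) ^ 2) + (1 - p0 - p1) * (Z * (5 / 4) ^ 10) ≤
          91 / 100 * (Z * (5 / 4) ^ 9) := by
        have : p0 * (5 / 4) ^ 8 + p1 * (5 / 4) ^ 2 + (1 - p0 - p1) * (5 / 4) ^ 10 ≤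
            91 / 100 * (5 / 4 : ℝ) ^ 9 := by
          norm_num
          linarith
        nlinarith
      linarith
    · obtain ⟨hp0', hp1'⟩ := hsmall h2
      rw [hp1'] at hW
      rw [e3, hp0', hp1']
      have : (1 / 2 : ℝ) * (Z * (5 / 4) ^ 9) + 1 / 2 * (Z * (5 / 4) ^ 2) ≤
          91 / 100 * (Z * (5 / 4) ^ 9) := by
        norm_num
        linarith
      linarith

end Beeping

/-! ### Reduction of the algorithm to a chain -/

namespace Beeping

open Algorithm

lemma perceived_top_eq_heardSilence_iff {V : Type} {B : Set V} {x : V} :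
    perceived (⊤ : SimpleGraph V) B x = .heardSilence ↔ B = ∅ := by
  constructor
  · intro h
    unfold perceived at h
    ext y
    split_ifs at h with h1 h2 h2
    simp only [Set.mem_empty_iff_false, iff_false]
    intro hy
    exact h2 ⟨y, fun hxy => h1 (hxy ▸ hy), hy⟩
  · rintro rfl
    simp [perceived]

lemma perceived_top_singleton {V : Type} [DecidableEq V] (x y : V) :
    perceived (⊤ : SimpleGraph V) {y} x = if x = y then .beepedAlone else .heardBeep := by
  unfold perceived
  by_cases h : x = y
  · subst h
    simp
  · simp [h]

lemma perceived_top_of_nontrivial {V : Type} [DecidableEq V] {B : Finset V}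
    (hB : 1 < B.card) (x : V) :
    perceived (⊤ : SimpleGraph V) (B : Set V) x =
      if x ∈ B then .beepedCollision else .heardBeep := by
  have : ∃ y, ¬ x = y ∧ y ∈ B := by
    obtain ⟨y, hy, hne⟩ := (Finset.one_lt_card_iff_nontrivial.1 hB).exists_ne x
    exact ⟨y, hne.symm, hy⟩
  unfold perceived
  by_cases h : x ∈ B <;> simp [h, this]

/-- One slot of the counting algorithm on a complete graph. -/
noncomputable def countStep {V : Type} (σ : V → CountState) (c : V → unitInterval) :
    V → CountState :=
  countAlgorithm.step ⊤ σ c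

lemma countStep_of_active {V : Type} {σ : V → CountState} {c : V → unitInterval} {B : Set V}
    (hσ : ∀ x, (σ x).terminated = false)
    (hB : ∀ x, (σ x).beep (c x) = true ↔ x ∈ B) (x : V) :
    countStep σ c x = (σ x).next (perceived ⊤ B x) := by
  have hout : ∀ x, countAlgorithm.output (σ x) = none := fun x => by simp [countAlgorithm, hσ x]
  have hfb : countAlgorithm.feedback ⊤ σ c x = perceived ⊤ B x :=
    feedback_eq_perceived (A := countAlgorithm) (fun y => by
      rw [← hB y]; exact and_iff_right (hout y)) x
  rw [← hfb]
  exact if_pos (hout x)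

lemma countStep_of_terminated {V : Type} {σ : V → CountState} {c : V → unitInterval}
    (hσ : ∀ x, (σ x).terminated = true) : countStep σ c = σ := by
  funext x
  have hout : countAlgorithm.output (σ x) ≠ none := by simp [countAlgorithm, hσ x]
  exact if_neg hout

section CountChain

variable {V : Type} [Fintype V] [DecidableEq V]

/-- The nodes outside `S` whose draw tells them to beep with probability `1 / k`. -/
noncomputable def beepers (S : Finset V) (k : ℕ) (c : V → unitInterval) : Finset V :=
  Sᶜ.filter fun x => (c x : ℝ) < 1 / (k : ℝ)

/-- The effect of a phase on the set of counted nodes and on the common value of `k`. -/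
noncomputable def chainStep (s : Finset V × ℕ) (c : V → unitInterval) : Finset V × ℕ :=
  if (beepers s.1 s.2 c).card = 0 then (s.1, if 2 < s.2 then s.2 - 1 else s.2)
  else if (beepers s.1 s.2 c).card = 1 then (s.1 ∪ beepers s.1 s.2 c, s.2)
  else (s.1, s.2 + 1)

/-- At the beginning of a phase, the nodes in `S` are counted and all active nodes agree on `k`. -/
def Represents (s : Finset V × ℕ) (σ : V → CountState) : Prop :=
  ∀ x, (σ x).size = 1 + (s.1.erase x).card ∧ (σ x).terminated = decide (s.1 = Finset.univ) ∧
    (s.1 ≠ Finset.univ → (σ x).slot = .one ∧ (σ x).counted = decide (x ∈ s.1) ∧ (σ x).k = s.2)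

lemma Represents.output_eq {s : Finset V × ℕ} {σ : V → CountState} (h : Represents s σ)
    (hs : s.1 = Finset.univ) (x : V) : countAlgorithm.output (σ x) = some (Fintype.card V) := by
  have h1 : (σ x).terminated = true := by rw [(h x).2.1]; simpa using hs
  have h2 : (σ x).size = Fintype.card V := by
    have : 0 < Fintype.card V := Fintype.card_pos_iff.2 ⟨x⟩
    rw [(h x).1, hs, Finset.card_erase_of_mem (Finset.mem_univ x), Finset.card_univ]
    omega
  simp [countAlgorithm, h1, h2]

lemma Represents.output_eq_none {s : Finset V × ℕ} {σ : V → CountState} (h : Represents s σ)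
    (hs : s.1 ≠ Finset.univ) (x : V) : countAlgorithm.output (σ x) = none := by
  have h1 : (σ x).terminated = false := by rw [(h x).2.1]; simpa using hs
  simp [countAlgorithm, h1]

/-- Slots 2 and 3 are determined by who beeped in slot 1. Once all nodes are counted they are frozen
while the `k` of the chain may still move, hence no claim about `k` then. -/
lemma Represents.phase {s : Finset V × ℕ} {σ : V → CountState} (h : Represents s σ)
    (c₁ c₂ c₃ : V → unitInterval) :
    Represents (chainStep s c₁)
      (countStep (countStep (countStep σ c₁) c₂) c₃) := by
  by_cases hs : s.1 = Finset.univ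
  · have hterm : ∀ x, (σ x).terminated = true := fun x => by rw [(h x).2.1]; simpa using hs
    rw [countStep_of_terminated hterm, countStep_of_terminated hterm, countStep_of_terminated hterm]
    have hstep : (chainStep s c₁).1 = s.1 := by
      unfold chainStep beepers
      simp [hs]
    intro x
    rw [hstep]
    exact ⟨(h x).1, (h x).2.1, fun hne => absurd hs hne⟩
  obtain ⟨S, k⟩ := s
  simp only at hs
  set B := beepers S k c₁ with hBdef
  have hsize : ∀ x, (σ x).size = 1 + (S.erase x).card := fun x => (h x).1
  have hterm : ∀ x, (σ x).terminated = false := fun x => by rw [(h x).2.1]; simpa using hs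
  have hslot : ∀ x, (σ x).slot = .one := fun x => ((h x).2.2 hs).1
  have hcounted : ∀ x, (σ x).counted = decide (x ∈ S) := fun x => ((h x).2.2 hs).2.1
  have hk : ∀ x, (σ x).k = k := fun x => ((h x).2.2 hs).2.2
  -- the set of nodes that beep in slot 2
  set B₂ : Finset V := if B.card = 1 then B else ∅ with hB₂def
  have hB₂ : ∀ x, perceived ⊤ (B : Set V) x = .beepedAlone ↔ x ∈ B₂ := by
    intro x
    rcases Nat.lt_trichotomy B.card 1 with h0 | h1 | h2
    · have hB : B = ∅ := Finset.card_eq_zero.1 (by omega)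
      simp [hB₂def, hB, perceived_top_eq_heardSilence_iff.2]
    · obtain ⟨y, hy⟩ := Finset.card_eq_one.1 h1
      rw [hB₂def, if_pos h1, hy, Finset.coe_singleton, perceived_top_singleton]
      simp
    · rw [perceived_top_of_nontrivial h2, hB₂def,
        if_neg h2.ne']
      split_ifs <;> simp
  have h1 : ∀ x, countStep σ c₁ x =
      { σ x with slot := .two, fb₁ := perceived ⊤ (B : Set V) x } := by
    intro x
    rw [countStep_of_active (B := (B : Set V)) hterm _ x]
    · simp [CountState.next, hslot]
    · intro x
      simp [CountState.beep, hslot, hcounted, hk, hBdef, beepers]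
  have h2 : ∀ x, countStep (countStep σ c₁) c₂ x =
      { σ x with
        slot := .three
        fb₁ := perceived ⊤ (B : Set V) x
        fb₂ := perceived ⊤ (B₂ : Set V) x
        counted := decide (x ∈ S ∪ B₂) } := by
    intro x
    rw [countStep_of_active (B := (B₂ : Set V)) _ _ x]
    · simp [h1, CountState.next, hcounted, hB₂]
    · intro x; rw [h1]; exact hterm x
    · intro x
      simp [h1, CountState.beep, hB₂]
  have h3 : ∀ x, countStep (countStep (countStep σ c₁) c₂) c₃ x =
      CountState.next { σ x with
        slot := .three
        fb₁ := perceived ⊤ (B : Set V) x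
        fb₂ := perceived ⊤ (B₂ : Set V) x
        counted := decide (x ∈ S ∪ B₂) } (perceived ⊤ (((S ∪ B₂)ᶜ : Finset V) : Set V) x) := by
    intro x
    rw [countStep_of_active (B := (((S ∪ B₂)ᶜ : Finset V) : Set V)) _ _ x, h2]
    · intro x; rw [h2]; exact hterm x
    · intro x
      rw [h2]
      simp [CountState.beep]
  have hS' : (chainStep (S, k) c₁).1 = S ∪ B₂ := by
    unfold chainStep
    simp only [← hBdef, hB₂def]
    split_ifs <;> simp_all
  have hfin : ∀ x, (decide (perceived ⊤ (((S ∪ B₂)ᶜ : Finset V) : Set V) x = .heardSilence)) =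
      decide (S ∪ B₂ = Finset.univ) := by
    intro x
    rw [decide_eq_decide, perceived_top_eq_heardSilence_iff, Finset.coe_eq_empty,
      Finset.compl_eq_empty_iff]
  intro x
  rw [hS', h3]
  refine ⟨?_, hfin x, fun _ => ⟨rfl, by simp [CountState.next], ?_⟩⟩
  · simp only [CountState.next]
    by_cases h1 : B.card = 1
    · obtain ⟨y, hy⟩ := Finset.card_eq_one.1 h1
      have hyS : y ∉ S := by
        have : y ∈ B := by simp [hy]
        simp only [hBdef, beepers, Finset.mem_filter, Finset.mem_compl] at this
        exact this.1
      rw [hB₂def, if_pos h1, hy, Finset.coe_singleton, perceived_top_singleton]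
      by_cases hxy : x = y
      · subst hxy
        simp [hsize]
      · have : (S ∪ {y}).erase x = insert y (S.erase x) := by
          ext z; simp; grind
        rw [this, Finset.card_insert_of_notMem (by simp [hyS])]
        simp [hxy, hsize, Nat.add_assoc]
    · rw [hB₂def, if_neg h1, Finset.coe_empty, perceived_top_eq_heardSilence_iff.2 rfl]
      simp [hsize]
  · simp only [CountState.next, CountState.newK, CountState.Collision, chainStep, ← hBdef, hk]
    rcases Nat.lt_trichotomy B.card 1 with h0 | h1 | h2
    · have hB : B = ∅ := Finset.card_eq_zero.1 (by omega)
      simp [hB, perceived_top_eq_heardSilence_iff.2]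
    · obtain ⟨y, hy⟩ := Finset.card_eq_one.1 h1
      rw [hB₂def, if_pos h1, hy, Finset.coe_singleton, perceived_top_singleton]
      by_cases hxy : x = y <;> simp [hxy]
    -- After a collision nobody beeps in slot 2; that silence tells the listeners, who only heard a
    -- beep, that it was a collision.
    · rw [perceived_top_of_nontrivial h2, hB₂def,
        if_neg h2.ne', Finset.coe_empty, perceived_top_eq_heardSilence_iff.2 rfl]
      have h0 : B.card ≠ 0 := by omega
      have h1 : B.card ≠ 1 := by omega
      by_cases hx : x ∈ B <;> simp [hx, h0, h1]

/-- The counted nodes and the common value of `k` after `j` phases, as a function of the draws in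
the first slots of the phases. -/
noncomputable def chain (ω : V → ℕ → unitInterval) : ℕ → Finset V × ℕ
  | 0 => (∅, 2)
  | j + 1 => chainStep (chain ω j) fun x => ω x (3 * j)

lemma represents_chain [Nonempty V] (ω : V → ℕ → unitInterval) (j : ℕ) :
    Represents (chain ω j) (countAlgorithm.run (⊤ : SimpleGraph V) ω (3 * j)) := by
  induction j with
  | zero =>
    intro x
    have : (∅ : Finset V) ≠ Finset.univ := Finset.univ_nonempty.ne_empty.symm
    simp [chain, run, countAlgorithm, CountState.start, this]
  | succ j ih => exact ih.phase _ _ _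

end CountChain

lemma Algorithm.output_run_of_le {A : Algorithm} {V : Type} {G : SimpleGraph V} {ω : A.Tape V}
    {t t' : ℕ} (h : t ≤ t') {x : V} {m : ℕ} (hm : A.output (A.run G ω t x) = some m) :
    A.output (A.run G ω t' x) = some m := by
  induction t', h using Nat.le_induction with
  | base => exact hm
  | succ t' _ ih =>
    have : A.run G ω (t' + 1) x = A.run G ω t' x := if_neg (by rw [ih]; simp)
    rw [this, ih]

/-- An output persists until the phase boundary `3 * t ≥ t`, where `Represents` fixes its value. -/
lemma eq_card_of_output_run {V : Type} [Fintype V] {ω : V → ℕ → unitInterval} {t : ℕ} {x : V}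
    {m : ℕ} (h : countAlgorithm.output (countAlgorithm.run (⊤ : SimpleGraph V) ω t x) = some m) :
    m = Fintype.card V := by
  classical
  have : Nonempty V := ⟨x⟩
  have h' := output_run_of_le (A := countAlgorithm) (by omega : t ≤ 3 * t) h
  have hrep := represents_chain ω t
  by_cases hs : (chain ω t).1 = Finset.univ
  · rw [hrep.output_eq hs] at h'
    exact (Option.some.inj h').symm
  · rw [hrep.output_eq_none hs] at h'
    cases h'

lemma slots_le_of_chain {V : Type} [Fintype V] [DecidableEq V] [Nonempty V]
    {ω : V → ℕ → unitInterval} {j : ℕ} (h : (chain ω j).1 = Finset.univ) :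
    countAlgorithm.slots (⊤ : SimpleGraph V) ω ≤ (3 * j : ℕ) :=
  slots_le_of_output fun x => by rw [(represents_chain ω j).output_eq h x]; simp

end Beeping

/-! ### Drift bound for a chain driven by independent draws -/

namespace Beeping

open Algorithm ProbabilityTheory
open scoped ENNReal

section MarkovChain

variable {V C : Type} {α : Type} {step : α → (V → C) → α} {X : (V → ℕ → C) → ℕ → α}

lemma chain_congr (h0 : ∀ ω ω', X ω 0 = X ω' 0)
    (hX : ∀ ω j, X ω (j + 1) = step (X ω j) fun x => ω x (3 * j)) {ω ω' : V → ℕ → C} {j : ℕ}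
    (h : ∀ x, ∀ t < 3 * j, ω x t = ω' x t) : X ω j = X ω' j := by
  induction j with
  | zero => exact h0 _ _
  | succ j ih =>
    rw [hX, hX, ih fun x t ht => h x t (by omega)]
    congr 1
    funext x
    exact h x _ (by omega)

variable [MeasurableSpace C] [MeasurableSpace α] [DiscreteMeasurableSpace α] [Countable α]

lemma measurable_chain (h0 : ∀ ω ω', X ω 0 = X ω' 0) (hstep : ∀ a, Measurable (step a))
    (hX : ∀ ω j, X ω (j + 1) = step (X ω j) fun x => ω x (3 * j)) (j : ℕ) :
    Measurable fun ω => X ω j := by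
  induction j with
  | zero =>
    rcases isEmpty_or_nonempty (V → ℕ → C) with h | ⟨⟨ω₀⟩⟩
    · exact measurable_of_empty _
    · simp only [fun ω => h0 ω ω₀]
      exact measurable_const
  | succ j ih =>
    simp only [hX]
    have h : Measurable fun p : α × (V → C) => step p.1 p.2 :=
      measurable_from_prod_countable_right hstep
    exact h.comp (ih.prodMk (by fun_prop : Measurable fun (ω : V → ℕ → C) x => ω x (3 * j)))

variable [Fintype V] {law : Measure C} [IsProbabilityMeasure law]

/-- The state after `j` phases depends only on draws before slot `3 * j`, a block of coordinates
disjoint from those of that slot. -/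
lemma indepFun_chain_draws (h0 : ∀ ω ω', X ω 0 = X ω' 0) (hstep : ∀ a, Measurable (step a))
    (hX : ∀ ω j, X ω (j + 1) = step (X ω j) fun x => ω x (3 * j)) (j : ℕ) :
    IndepFun (fun ω => X ω j) (fun (ω : V → ℕ → C) x => ω x (3 * j))
      (Measure.pi fun _ : V => Measure.infinitePi fun _ : ℕ => law) := by
  classical
  obtain ⟨c₀⟩ : Nonempty C := law.nonempty_of_neZero
  have hind : iIndepFun (fun (p : V × ℕ) (ω : V → ℕ → C) => ω p.1 p.2)
      (Measure.pi fun _ : V => Measure.infinitePi fun _ : ℕ => law) := by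
    have := iIndepFun_uncurry_infinitePi' (X := fun (_ : V) (_ : ℕ) (c : C) => c)
      (fun (_ : V) (_ : ℕ) => law) (fun _ _ => measurable_id)
    rwa [Measure.infinitePi_eq_pi] at this
  let S : Finset (V × ℕ) := Finset.univ ×ˢ Finset.range (3 * j)
  let T : Finset (V × ℕ) := Finset.univ ×ˢ {3 * j}
  have hST : Disjoint S T := by
    rw [Finset.disjoint_left]
    rintro ⟨x, t⟩ h1 h2
    simp only [S, T, Finset.mem_product, Finset.mem_range, Finset.mem_singleton] at h1 h2
    omega
  have h := hind.indepFun_finset S T hST fun p => by fun_prop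
  -- Padding the unread draws with `c₀` exhibits `X ω j` as a function of finitely many coordinates;
  -- `chain_congr` shows the padding is harmless.
  let extend : (S → C) → V → ℕ → C := fun y x t => if h : (x, t) ∈ S then y ⟨(x, t), h⟩ else c₀
  have hextend : Measurable extend := by
    refine measurable_pi_lambda _ fun x => measurable_pi_lambda _ fun t => ?_
    by_cases hm : (x, t) ∈ S
    · simp only [extend, hm, dite_true]
      fun_prop
    · simp only [extend, hm, dite_false]
      fun_prop
  have hT : ∀ x, (x, 3 * j) ∈ T := fun x => by simp [T]
  have hread : Measurable fun (y : T → C) (x : V) => y ⟨(x, 3 * j), hT x⟩ := by fun_prop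
  have := h.comp ((measurable_chain h0 hstep hX j).comp hextend) hread
  have heq : (fun ω => X ω j) =
      ((fun ω => X ω j) ∘ extend) ∘ fun (ω : V → ℕ → C) (p : S) => ω p.1.1 p.1.2 := by
    funext ω
    refine chain_congr h0 hX fun x t ht => ?_
    have : (x, t) ∈ S := by simp [S, ht]
    simp [extend, this]
  rw [heq]
  exact this

lemma map_draws (t : ℕ) :
    (Measure.pi fun _ : V => Measure.infinitePi fun _ : ℕ => law).map (fun ω x => ω x t) =
      Measure.pi fun _ : V => law := by
  have hmap : ∀ _ : V, (Measure.infinitePi fun _ : ℕ => law).map (fun y => y t) = law :=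
    fun _ => Measure.infinitePi_map_eval (μ := fun _ : ℕ => law) t
  have : ∀ i : V, SigmaFinite ((Measure.infinitePi fun _ : ℕ => law).map fun y => y t) :=
    fun i => by rw [hmap i]; infer_instance
  rw [Measure.pi_map_pi (f := fun (_ : V) (y : ℕ → C) => y t)
    fun _ => (measurable_pi_apply t).aemeasurable]
  exact congrArg Measure.pi (funext hmap)

/-- The geometric drift bound for a chain driven by the draws in every third slot. -/
lemma lintegral_chain_le {f : α → ℝ≥0∞} {q : ℝ≥0∞} {P : α → Prop} {a₀ : α}
    (h0 : ∀ ω, X ω 0 = a₀) (hstep : ∀ a, Measurable (step a))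
    (hX : ∀ ω j, X ω (j + 1) = step (X ω j) fun x => ω x (3 * j))
    (hP0 : P a₀) (hP : ∀ a c, P a → P (step a c))
    (hf : ∀ a, P a → ∫⁻ c, f (step a c) ∂(Measure.pi fun _ : V => law) ≤ q * f a) (j : ℕ) :
    ∫⁻ ω, f (X ω j) ∂(Measure.pi fun _ : V => Measure.infinitePi fun _ : ℕ => law) ≤
      q ^ j * f a₀ := by
  have h0' : ∀ ω ω', X ω 0 = X ω' 0 := fun ω ω' => by rw [h0, h0]
  have hPX : ∀ ω j, P (X ω j) := by
    intro ω j
    induction j with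
    | zero => rw [h0]; exact hP0
    | succ j ih => rw [hX]; exact hP _ _ ih
  induction j with
  | zero => simp [h0]
  | succ j ih =>
    have hmX := measurable_chain h0' hstep hX j
    have hmY : Measurable fun (ω : V → ℕ → C) x => ω x (3 * j) := by fun_prop
    have hms : Measurable fun p : α × (V → C) => f (step p.1 p.2) :=
      (Measurable.of_discrete (f := f)).comp (measurable_from_prod_countable_right hstep)
    calc ∫⁻ ω, f (X ω (j + 1)) ∂(Measure.pi fun _ : V => Measure.infinitePi fun _ : ℕ => law)
        = ∫⁻ p, f (step p.1 p.2) ∂((Measure.pi fun _ : V => Measure.infinitePi fun _ : ℕ =>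
            law).map fun ω => (X ω j, fun x => ω x (3 * j))) := by
          rw [lintegral_map hms (hmX.prodMk hmY)]
          simp only [hX]
      _ = ∫⁻ a, ∫⁻ c, f (step a c) ∂(Measure.pi fun _ : V => law)
            ∂((Measure.pi fun _ : V => Measure.infinitePi fun _ : ℕ => law).map fun ω => X ω j) := by
          -- Independence makes the joint law a product, so Tonelli isolates the one-step
          -- expectation.
          rw [(indepFun_chain_draws h0' hstep hX j).map_prod_eq_prod_map_map hmX.aemeasurable
            hmY.aemeasurable, map_draws, lintegral_prod _ hms.aemeasurable]
      _ = ∫⁻ ω, ∫⁻ c, f (step (X ω j) c) ∂(Measure.pi fun _ : V => law)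
            ∂(Measure.pi fun _ : V => Measure.infinitePi fun _ : ℕ => law) :=
          lintegral_map Measurable.of_discrete hmX
      _ ≤ ∫⁻ ω, q * f (X ω j) ∂(Measure.pi fun _ : V => Measure.infinitePi fun _ : ℕ => law) :=
          lintegral_mono fun ω => hf _ (hPX ω j)
      _ = q * ∫⁻ ω, f (X ω j) ∂(Measure.pi fun _ : V => Measure.infinitePi fun _ : ℕ => law) :=
          lintegral_const_mul _ ((Measurable.of_discrete (f := f)).comp hmX)
      _ ≤ q * (q ^ j * f a₀) := by gcongr
      _ = q ^ (j + 1) * f a₀ := by rw [pow_succ']; ring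

/-- Markov's inequality at level 1. -/
lemma measure_chain_le {f : α → ℝ≥0∞} {q : ℝ≥0∞} {P : α → Prop} {a₀ : α}
    (h0 : ∀ ω, X ω 0 = a₀) (hstep : ∀ a, Measurable (step a))
    (hX : ∀ ω j, X ω (j + 1) = step (X ω j) fun x => ω x (3 * j))
    (hP0 : P a₀) (hP : ∀ a c, P a → P (step a c))
    (hf : ∀ a, P a → ∫⁻ c, f (step a c) ∂(Measure.pi fun _ : V => law) ≤ q * f a) (j : ℕ) :
    (Measure.pi fun _ : V => Measure.infinitePi fun _ : ℕ => law) {ω | 1 ≤ f (X ω j)} ≤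
      q ^ j * f a₀ := by
  have h0' : ∀ ω ω', X ω 0 = X ω' 0 := fun ω ω' => by rw [h0, h0]
  refine le_trans (meas_le_lintegral₀ ?_ fun _ h => h) (lintegral_chain_le h0 hstep hX hP0 hP hf j)
  exact ((Measurable.of_discrete (f := f)).comp (measurable_chain h0' hstep hX j)).aemeasurable

end MarkovChain

/-! ### Outcome probabilities and tail bound for the counting chain -/

section CountChain

variable {V : Type} [Fintype V] [DecidableEq V]

lemma volume_real_lt_inv {k : ℕ} (hk : 2 ≤ k) :
    (volume : Measure unitInterval).real {c | (c : ℝ) < 1 / k} = 1 / k := by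
  have hmem : (1 / k : ℝ) ∈ unitInterval := by
    obtain ⟨h0, h1⟩ := one_sub_inv_mem hk
    exact ⟨by linarith, by linarith⟩
  have : {c : unitInterval | (c : ℝ) < 1 / k} = Set.Iio ⟨1 / k, hmem⟩ := rfl
  rw [this, measureReal_def, unitInterval.volume_Iio, ENNReal.toReal_ofReal hmem.1]

lemma volume_real_inv_le {k : ℕ} (hk : 2 ≤ k) :
    (volume : Measure unitInterval).real {c | 1 / (k : ℝ) ≤ c} = 1 - 1 / k := by
  have hm : MeasurableSet {c : unitInterval | (c : ℝ) < 1 / k} :=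
    measurableSet_lt measurable_subtype_coe measurable_const
  have := probReal_compl_eq_one_sub (μ := (volume : Measure unitInterval)) hm
  rw [volume_real_lt_inv hk] at this
  rw [← this]
  congr 1
  ext c
  simp

lemma measurableSet_lt_inv (k : ℕ) : MeasurableSet {c : unitInterval | (c : ℝ) < 1 / k} :=
  measurableSet_lt measurable_subtype_coe measurable_const

lemma measurableSet_beepers_eq (S : Finset V) (k : ℕ) (B : Finset V) :
    MeasurableSet {c | beepers S k c = B} := by
  have hm : Measurable fun (c : V → unitInterval) x => decide ((c x : ℝ) < 1 / k) := by
    refine measurable_pi_lambda _ fun x => ?_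
    exact (measurable_to_bool (f := fun c : unitInterval => decide ((c : ℝ) < 1 / k))
      (by simpa [Set.preimage] using measurableSet_lt_inv k)).comp (measurable_pi_apply x)
  have : {c | beepers S k c = B} = (fun (c : V → unitInterval) x => decide ((c x : ℝ) < 1 / k)) ⁻¹'
      {b | (Sᶜ.filter fun x => b x = true) = B} := by
    ext c
    simp [beepers]
  rw [this]
  exact hm (MeasurableSet.of_discrete)

lemma measurable_chainStep [MeasurableSpace (Finset V × ℕ)] (s : Finset V × ℕ) :
    Measurable (chainStep s) := by
  let g : Finset V → Finset V × ℕ := fun B =>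
    if B.card = 0 then (s.1, if 2 < s.2 then s.2 - 1 else s.2)
    else if B.card = 1 then (s.1 ∪ B, s.2) else (s.1, s.2 + 1)
  have hg : chainStep s = g ∘ beepers s.1 s.2 := rfl
  let _ : MeasurableSpace (Finset V) := ⊤
  have hb : Measurable (beepers s.1 s.2) :=
    measurable_to_countable' fun B => measurableSet_beepers_eq s.1 s.2 B
  rw [hg]
  exact measurable_from_top.comp hb

lemma measureReal_beepers_eq {S : Finset V} {k : ℕ} (hk : 2 ≤ k) {B : Finset V}
    (hB : B ⊆ Sᶜ) :
    (Measure.pi fun _ : V => (volume : Measure unitInterval)).real {c | beepers S k c = B} =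
      (1 / k) ^ B.card * (1 - 1 / k) ^ (Sᶜ.card - B.card) := by
  -- The event is a box: prescribed beepers draw below `1/k`, the other uncounted nodes do not, and
  -- counted nodes are free.
  let E : V → Set unitInterval := fun x =>
    if x ∈ B then {c | (c : ℝ) < 1 / k} else if x ∈ Sᶜ then {c | 1 / (k : ℝ) ≤ c} else Set.univ
  have hE : {c | beepers S k c = B} = Set.univ.pi E := by
    ext c
    simp only [Set.mem_ofPred_eq, Set.mem_univ_pi, beepers, Finset.ext_iff, Finset.mem_filter]
    refine forall_congr' fun x => ?_
    by_cases h1 : x ∈ B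
    · have := hB h1
      simp [E, h1, this, -Finset.mem_compl]
    · by_cases h2 : x ∈ Sᶜ <;> simp [E, h1, h2, -Finset.mem_compl]
  rw [hE, measureReal_def, Measure.pi_pi, ENNReal.toReal_prod]
  have hx : ∀ x, ((volume : Measure unitInterval) (E x)).toReal =
      (if x ∈ B then (1 / k : ℝ) else 1) * (if x ∈ Sᶜ \ B then (1 - 1 / k : ℝ) else 1) := by
    intro x
    rw [← measureReal_def]
    by_cases h1 : x ∈ B
    · simp only [E, h1, if_true, volume_real_lt_inv hk]
      simp [h1]
    · by_cases h2 : x ∈ Sᶜ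
      · simp only [E, h1, h2, if_true, if_false, volume_real_inv_le hk]
        rw [if_pos (by simp [h1, h2, -Finset.mem_compl])]
        simp
      · simp [E, h1, h2, -Finset.mem_compl]
  simp only [hx]
  rw [Finset.prod_mul_distrib, Finset.prod_ite_mem, Finset.prod_ite_mem, Finset.univ_inter,
    Finset.univ_inter, Finset.prod_const, Finset.prod_const, Finset.card_sdiff_of_subset hB]

lemma measureReal_silence {S : Finset V} {k : ℕ} (hk : 2 ≤ k) :
    (Measure.pi fun _ : V => (volume : Measure unitInterval)).real
      {c | (beepers S k c).card = 0} = (1 - 1 / k) ^ Sᶜ.card := by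
  have := measureReal_beepers_eq (S := S) hk (Finset.empty_subset _)
  simpa [Finset.card_eq_zero] using this

lemma setOf_beepers_card_eq_one (S : Finset V) (k : ℕ) :
    {c | (beepers S k c).card = 1} = ⋃ x ∈ Sᶜ, {c | beepers S k c = {x}} := by
  ext c
  simp only [Set.mem_ofPred_eq, Finset.card_eq_one, Set.mem_iUnion, exists_prop]
  constructor
  · rintro ⟨x, hx⟩
    have : x ∈ beepers S k c := by simp [hx]
    exact ⟨x, (Finset.mem_filter.1 this).1, hx⟩
  · rintro ⟨x, -, hx⟩
    exact ⟨x, hx⟩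

lemma measureReal_alone {S : Finset V} {k : ℕ} (hk : 2 ≤ k) :
    (Measure.pi fun _ : V => (volume : Measure unitInterval)).real
      {c | (beepers S k c).card = 1} = aloneProb Sᶜ.card k := by
  rw [setOf_beepers_card_eq_one, measureReal_biUnion_finset]
  · rw [Finset.sum_congr rfl fun x hx =>
      measureReal_beepers_eq hk (Finset.singleton_subset_iff.2 hx)]
    simp [aloneProb]
  · intro x _ y _ hxy
    rw [Function.onFun, Set.disjoint_left]
    intro c hx hy
    exact hxy (Finset.singleton_injective (hx.symm.trans hy))
  · exact fun x _ => measurableSet_beepers_eq S k {x}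

lemma lintegral_weight_chainStep_le {s : Finset V × ℕ} (hk : 2 ≤ s.2) :
    ∫⁻ c, ENNReal.ofReal (weight (chainStep s c).1ᶜ.card (chainStep s c).2)
        ∂(Measure.pi fun _ : V => (volume : Measure unitInterval)) ≤
      ENNReal.ofReal (91 / 100) * ENNReal.ofReal (weight s.1ᶜ.card s.2) := by
  obtain ⟨S, k⟩ := s
  simp only at hk ⊢
  rw [← ENNReal.ofReal_mul (by norm_num)]
  rcases Nat.eq_zero_or_pos Sᶜ.card with h0 | hpos
  · have hS : Sᶜ = ∅ := Finset.card_eq_zero.1 h0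
    have h : ∀ c : V → unitInterval, (chainStep (S, k) c).1ᶜ.card = 0 := by
      intro c
      simp [chainStep, beepers, hS]
    simp [h, weight]
  set ν := Measure.pi fun _ : V => (volume : Measure unitInterval)
  set w₀ := weight Sᶜ.card (if 2 < k then k - 1 else k)
  set w₁ := weight (Sᶜ.card - 1) k
  set w₂ := weight Sᶜ.card (k + 1)
  set E₀ := {c : V → unitInterval | (beepers S k c).card = 0} with hE₀
  set E₁ := {c : V → unitInterval | (beepers S k c).card = 1} with hE₁
  have hm₀ : MeasurableSet E₀ := by
    simpa only [hE₀, Finset.card_eq_zero] using measurableSet_beepers_eq S k ∅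
  have hm₁ : MeasurableSet E₁ := by
    rw [hE₁, setOf_beepers_card_eq_one]
    exact Finset.measurableSet_biUnion _ fun x _ => measurableSet_beepers_eq S k {x}
  -- Taking the collision value `w₂` as baseline, only the probabilities of silence and of a lone
  -- beep are needed.
  have hval : ∀ c, weight (chainStep (S, k) c).1ᶜ.card (chainStep (S, k) c).2 =
      E₀.indicator (fun _ => w₀ - w₂) c + E₁.indicator (fun _ => w₁ - w₂) c + w₂ := by
    intro c
    by_cases h0 : (beepers S k c).card = 0
    · have h1 : c ∉ E₁ := by simp only [hE₁, Set.mem_ofPred_eq, h0]; norm_num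
      rw [Set.indicator_of_mem (show c ∈ E₀ from h0), Set.indicator_of_notMem h1]
      simp only [chainStep, h0, if_true]
      ring
    by_cases h1 : (beepers S k c).card = 1
    · rw [Set.indicator_of_notMem (show c ∉ E₀ from h0), Set.indicator_of_mem (show c ∈ E₁ from h1)]
      have hcard : (S ∪ beepers S k c)ᶜ.card = Sᶜ.card - 1 := by
        have hsub : beepers S k c ⊆ Sᶜ := Finset.filter_subset _ _
        rw [Finset.compl_union, ← Finset.sdiff_eq_inter_compl, Finset.card_sdiff_of_subset hsub, h1]
      have hstep : chainStep (S, k) c = (S ∪ beepers S k c, k) := by simp [chainStep, h1]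
      rw [hstep, hcard]
      ring
    · rw [Set.indicator_of_notMem (show c ∉ E₀ from h0), Set.indicator_of_notMem (show c ∉ E₁ from h1)]
      simp only [chainStep, h0, h1, if_false]
      ring
  have hi₀ : Integrable (E₀.indicator fun _ => w₀ - w₂) ν :=
    (integrable_const _).indicator hm₀
  have hi₁ : Integrable (E₁.indicator fun _ => w₁ - w₂) ν :=
    (integrable_const _).indicator hm₁
  have hint : ∫ c, weight (chainStep (S, k) c).1ᶜ.card (chainStep (S, k) c).2 ∂ν =
      (1 - 1 / k : ℝ) ^ Sᶜ.card * w₀ + aloneProb Sᶜ.card k * w₁ +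
        (1 - (1 - 1 / k : ℝ) ^ Sᶜ.card - aloneProb Sᶜ.card k) * w₂ := by
    simp only [hval]
    rw [integral_add (f := fun c => E₀.indicator (fun _ => w₀ - w₂) c +
        E₁.indicator (fun _ => w₁ - w₂) c) (hi₀.add hi₁) (integrable_const _),
      integral_add hi₀ hi₁,
      integral_indicator_const _ hm₀, integral_indicator_const _ hm₁, integral_const,
      measureReal_silence hk, measureReal_alone hk]
    simp only [smul_eq_mul, probReal_univ]
    ring
  rw [← ofReal_integral_eq_lintegral_ofReal, hint]
  · exact ENNReal.ofReal_le_ofReal (weight_drift hpos hk)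
  · simp only [hval]
    exact (hi₀.add hi₁).add (integrable_const _)
  · exact Eventually.of_forall fun c => weight_nonneg _ _

lemma prob_chain_ne_univ_le [Nonempty V] (j : ℕ) :
    countAlgorithm.prob V {ω | (chain ω j).1 ≠ Finset.univ} ≤
      ENNReal.ofReal ((91 / 100) ^ j * (5 / 4) ^ (9 * Fintype.card V)) := by
  let _ : MeasurableSpace (Finset V × ℕ) := ⊤
  have : DiscreteMeasurableSpace (Finset V × ℕ) := ⟨fun _ => trivial⟩
  have h := measure_chain_le (V := V) (law := (volume : Measure unitInterval))
    (f := fun s : Finset V × ℕ => ENNReal.ofReal (weight s.1ᶜ.card s.2))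
    (q := ENNReal.ofReal (91 / 100)) (P := fun s => 2 ≤ s.2) (X := chain) (a₀ := (∅, 2))
    (fun _ => rfl) measurable_chainStep (fun _ _ => rfl) le_rfl
    (fun s c hs => by
      unfold chainStep
      split_ifs <;> simp only <;> omega)
    (fun s hs => lintegral_weight_chainStep_le hs) j
  have hcard : 0 < Fintype.card V := Fintype.card_pos
  calc countAlgorithm.prob V {ω | (chain ω j).1 ≠ Finset.univ}
      ≤ countAlgorithm.prob V
          {ω | 1 ≤ ENNReal.ofReal (weight (chain ω j).1ᶜ.card (chain ω j).2)} := by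
        refine measure_mono fun ω hω => ?_
        have : 1 ≤ (chain ω j).1ᶜ.card := by
          rw [Nat.one_le_iff_ne_zero, Ne, Finset.card_eq_zero, Finset.compl_eq_empty_iff]
          exact hω
        simpa using one_le_weight this _
    _ ≤ _ := h
    _ ≤ _ := by
        rw [← ENNReal.ofReal_pow (by norm_num), ← ENNReal.ofReal_mul (by positivity)]
        refine ENNReal.ofReal_le_ofReal (mul_le_mul_of_nonneg_left ?_ (by positivity))
        refine (weight_le _ _).trans (pow_le_pow_right₀ (by norm_num) ?_)
        simp only [Finset.compl_empty, Finset.card_univ]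
        -- The initial exponent is `8n + |n - 2|`; `n ≥ 1` is needed for the bound `9n`, with
        -- equality at `n = 1`.
        omega

end CountChain

/-! ### Termination, running time and optimality -/

theorem countAlgorithm_isLasVegasCounting : countAlgorithm.IsLasVegasCounting := by
  intro n hn
  have : Nonempty (Fin n) := ⟨⟨0, hn⟩⟩
  have hnull : countAlgorithm.prob (Fin n) {ω | ∀ j, (chain ω j).1 ≠ Finset.univ} = 0 := by
    have hlim : Tendsto (fun j : ℕ => ENNReal.ofReal ((91 / 100) ^ j * (5 / 4) ^ (9 * Fintype.card (Fin n))))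
        atTop (nhds 0) := by
      rw [← ENNReal.ofReal_zero]
      refine ENNReal.tendsto_ofReal ?_
      simpa using (tendsto_pow_atTop_nhds_zero_of_lt_one (r := (91 / 100 : ℝ)) (by norm_num)
        (by norm_num)).mul_const ((5 / 4 : ℝ) ^ (9 * Fintype.card (Fin n)))
    refine le_antisymm (ge_of_tendsto' hlim fun j => ?_) zero_le
    refine (measure_mono fun ω hω => ?_).trans (prob_chain_ne_univ_le j)
    rw [Set.mem_ofPred_eq] at hω ⊢
    exact hω j
  filter_upwards [measure_eq_zero_iff_ae_notMem.1 hnull] with ω hω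
  refine ⟨?_, fun t x m hm => by simpa using eq_card_of_output_run hm⟩
  simp only [not_forall, not_not] at hω
  obtain ⟨j, hj⟩ := hω
  exact (slots_le_of_chain hj).trans_lt (ENat.natCast_lt_top _)

theorem countAlgorithm_withHighProbability :
    countAlgorithm.WithHighProbability
      (fun n => {ω | countAlgorithm.slots (oneHop n) ω ≤ (165 * n : ℕ)}) := by
  have hbound : ∀ n : ℕ, 1 ≤ n → (countAlgorithm.prob (Fin n)).real
      {ω | countAlgorithm.slots (oneHop n) ω ≤ (165 * n : ℕ)}ᶜ ≤ (1 / 2) ^ n := by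
    intro n hn
    have : Nonempty (Fin n) := ⟨⟨0, hn⟩⟩
    refine ENNReal.toReal_le_of_le_ofReal (by positivity) ?_
    calc _ ≤ countAlgorithm.prob (Fin n) {ω | (chain ω (55 * n)).1 ≠ Finset.univ} := by
          refine measure_mono fun ω hω hj => hω ?_
          have := slots_le_of_chain hj
          rwa [show 3 * (55 * n) = 165 * n by ring] at this
      _ ≤ _ := prob_chain_ne_univ_le _
      _ ≤ _ := by
          refine ENNReal.ofReal_le_ofReal ?_
          -- The choice of 55 phases per node rests on `(91/100) ^ 55 * (5/4) ^ 9 ≤ 1/2`.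
          rw [Fintype.card_fin, pow_mul, pow_mul, ← mul_pow]
          exact pow_le_pow_left₀ (by positivity) (by norm_num) n
  have hlim : (fun n : ℕ => (1 / 2 : ℝ) ^ n) =o[atTop] fun n : ℕ => (n : ℝ)⁻¹ := by
    rw [Asymptotics.isLittleO_iff_tendsto' ?_]
    · have := tendsto_self_mul_const_pow_of_lt_one (r := (1 / 2 : ℝ)) (by norm_num) (by norm_num)
      refine this.congr fun n => ?_
      rw [div_inv_eq_mul, mul_comm]
    · filter_upwards [eventually_ge_atTop 1] with n hn h
      have : (n : ℝ) ≠ 0 := by exact_mod_cast (by omega : n ≠ 0)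
      simp_all
  refine Asymptotics.IsBigO.trans_isLittleO (Asymptotics.IsBigO.of_bound 1 ?_) hlim
  filter_upwards [eventually_ge_atTop 1] with n hn
  rw [Real.norm_of_nonneg measureReal_nonneg, Real.norm_of_nonneg (by positivity), one_mul]
  exact hbound n hn

instance Algorithm.isProbabilityMeasure_prob (A : Algorithm) (V : Type) [Fintype V] :
    IsProbabilityMeasure (A.prob V) := by
  unfold Algorithm.prob
  infer_instance

lemma Algorithm.WithHighProbability.mono {A : Algorithm} {E E' : ∀ n : ℕ, Set (A.Tape (Fin n))}
    (h : A.WithHighProbability E) (hE : ∀ᶠ n in atTop, E n ⊆ E' n) : A.WithHighProbability E' := by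
  refine Asymptotics.IsBigO.trans_isLittleO (Asymptotics.IsBigO.of_bound 1 ?_) h
  filter_upwards [hE] with n hn
  rw [Real.norm_of_nonneg measureReal_nonneg, Real.norm_of_nonneg measureReal_nonneg, one_mul]
  exact measureReal_mono (Set.compl_subset_compl.2 hn)

end Beeping

open Beeping Algorithm in
theorem corollary1 :
    -- it is a Las Vegas counting algorithm,
    countAlgorithm.IsLasVegasCounting ∧
    -- it takes at most `165 n` slots with high probability,
    countAlgorithm.WithHighProbability
      (fun n => {ω | countAlgorithm.slots (oneHop n) ω ≤ (165 * n : ℕ)}) ∧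
    -- every Las Vegas counting algorithm takes at least `n` slots,
    (∀ A : Algorithm, A.IsLasVegasCounting → ∀ n : ℕ, 1 ≤ n →
      ∀ᵐ ω ∂A.prob (Fin n), (n : ℕ∞) ≤ A.slots (oneHop n) ω) ∧
    -- and so it is optimal up to the factor `165`
    countAlgorithm.IsOptimalUpTo 165 := by
  refine ⟨countAlgorithm_isLasVegasCounting, countAlgorithm_withHighProbability,
    fun A hA n hn => hA.le_slots hn, countAlgorithm_isLasVegasCounting, fun B hB t ht => ?_⟩
  refine countAlgorithm_withHighProbability.mono ?_
  filter_upwards [ht, eventually_ge_atTop 1] with n hpos hn ω hω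
  -- A positive chance of finishing within `t n` slots is incompatible with the almost sure lower
  -- bound unless `n ≤ t n`.
  have hnt : n ≤ t n := by
    by_contra! hlt
    refine hpos.ne' (measure_mono_null ?_ (ae_iff.1 (hB.le_slots hn)))
    intro ω' hω' hle
    have : (n : ℕ∞) ≤ t n := hle.trans hω'
    exact absurd (Nat.cast_le.1 this) (by omega)
  refine le_trans (Set.mem_ofPred_eq ▸ hω) ?_
  exact_mod_cast Nat.mul_le_mul_left 165 hnt
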